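/- Let $K$ be a field and $S=K[x_{12},x_{14},x_{15},x_{23},x_{26},x_{34},x_{37},x_{48},x_{56},x_{58},x_{67},x_{78}]$, with one variable for each edge of the cube graph on the vertices $1,\dots,8$ (edges $12,14,15,23,26,34,37,48,56,58,67,78$). Definitions. A grading of $S$ is given by an abelian group $\mathcal H$ with a distinguished family of generators $\mathbf h_{ij}$, one for each variable, $\mathbf h_{ij}$ being the degree of $x_{ij}$. A polynomial is $\mathcal H$-homogeneous if all its monomials have the same degree, and an ideal is $\mathcal H$-homogeneous if it is generated by $\mathcal H$-homogeneous polynomials. Write $\mathcal F\le\mathcal H$ ($\mathcal F$ is a specialization of $\mathcal H$) if every $\mathcal H$-homogeneous ideal of $S$ is $\mathcal F$-homogeneous; two gradings are equivalent if they have the same homogeneous ideals. For an ideal $J$, $\mathrm{ara}_{\mathcal H}(J)$ is the smallest $s$ such that $\mathrm{rad}(J)=\mathrm{rad}(F_1,\dots,F_s)$ for some $\mathcal H$-homogeneous $F_1,\dots,F_s\in S$, and $J$ is an $\mathcal H$-homogeneous set-theoretic complete intersection if $\mathrm{ht}(J)=\mathrm{ara}_{\mathcal H}(J)$. Let $\mathcal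 G=\mathbb ZA$ be the subgroup of $\mathbb Z^8$ generated by $\mathbf a_{ij}=\mathbf e_i+\mathbf e_j$, $ij$ an edge, and let $\mathcal F=\mathbb ZB$ be the subgroup of $\mathbb Z^4$ generated by $\mathbf b_{12}=(5,0,3,4)$, $\mathbf b_{14}=(3,1,5,5)$, $\mathbf b_{15}=(4,1,4,8)$, $\mathbf b_{23}=(4,0,2,3)$, $\mathbf b_{26}=(5,0,1,6)$, $\mathbf b_{34}=(2,1,4,4)$, $\mathbf b_{37}=(2,1,2,6)$, $\mathbf b_{48}=(1,2,5,8)$, $\mathbf b_{56}=(4,1,2,10)$, $\mathbf b_{58}=(2,2,4,11)$, $\mathbf b_{67}=(3,1,1,9)$, $\mathbf b_{78}=(1,2,3,10)$, each with the listed generators. Let $L_{\mathcal G}=\{u\in\mathbb Z^{12}:\sum u_{ij}\mathbf a_{ij}=\mathbf 0\}$ and let $I=(x^{\alpha_+}-x^{\alpha_-}:\alpha\in L_{\mathcal G})\subset S$, where $\alpha_+$ and $\alpha_-$ are the positive and negative parts of $\alpha$. Then $I$ is prime, $I$ is the kernel of the $K$-algebra homomorphism $S\to K[t_1,\dots,t_8]$,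 $x_{ij}\mapsto t_it_j$ (the toric ideal of the cube graph), $\mathcal F\le\mathcal G$, and $$\mathrm{ara}_{\mathcal G}(I)=10,\qquad \mathrm{ara}_{\mathcal F}(I)=7,\qquad \mathrm{ht}(I)=5.$$ For every grading $\mathcal H$ with $\mathcal F\le\mathcal H\le\mathcal G$ one has $7\le\mathrm{ara}_{\mathcal H}(I)\le 10$, and $I$ is not an $\mathcal H$-homogeneous set-theoretic complete intersection. There are infinitely many equivalence classes of gradings $\mathcal H$ with $\mathcal F\le\mathcal H\le\mathcal G$. -/

import Mathlib

universe u v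

/-- A grading datum on `K[x_i : i ∈ σ]`: an abelian group together with a distinguished family of
generators indexed by the variables (`gen i` is the degree of `x_i`). -/
structure Grading (σ : Type) where
  carrier : Type u
  [addCommGroup : AddCommGroup carrier]
  gen : σ → carrier
  closure_range_gen : AddSubgroup.closure (Set.range gen) = ⊤

attribute [instance] Grading.addCommGroup

namespace Grading

variable {σ : Type}

/-- The lattice `ℤB` spanned by a family of vectors `b`, with the vectors as its generators. -/
def ofVectors {M : Type u} [AddCommGroup M] (b : σ → M) : Grading.{u} σ where
  carrier := AddSubgroup.closure (Set.range b)
  gen i := ⟨b i, AddSubgroup.subset_closure ⟨i, rfl⟩⟩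
  closure_range_gen := by
    rw [← AddSubgroup.closure_closure_coe_preimage (k := Set.range b)]
    congr 1
    ext ⟨x, hx⟩
    simp [Subtype.ext_iff]

/-- The degree map `ℤ^σ → 𝓖`, `u ↦ ∑ u_i g_i`. -/
def deg [Fintype σ] (G : Grading.{u} σ) : (σ → ℤ) →+ G.carrier where
  toFun c := ∑ i, c i • G.gen i
  map_zero' := by simp
  map_add' c d := by simp [add_smul, Finset.sum_add_distrib]

/-- The lattice `L_𝓖` of relations of the generators. -/
def relLattice [Fintype σ] (G : Grading.{u} σ) : AddSubgroup (σ → ℤ) := G.deg.ker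

section

variable {K : Type v} [Field K]

/-- `p` is `𝓖`-homogeneous: all its monomials have the same `𝓖`-degree. -/
def IsHomogeneous (G : Grading.{u} σ) (p : MvPolynomial σ K) : Prop :=
  ∃ d : G.carrier, MvPolynomial.IsWeightedHomogeneous G.gen p d

/-- `J` is `𝓖`-homogeneous: it is generated by `𝓖`-homogeneous polynomials. -/
def IsHomogeneousIdeal (G : Grading.{u} σ) (J : Ideal (MvPolynomial σ K)) : Prop :=
  ∃ S : Set (MvPolynomial σ K), (∀ p ∈ S, G.IsHomogeneous p) ∧ Ideal.span S = J

/-- The `𝓖`-homogeneous arithmetical rank: the smallest `s` such that `rad J = rad (F_1, …, F_s)`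
for some `𝓖`-homogeneous polynomials `F_1, …, F_s` (and `⊤` if there is no such `s`). -/
noncomputable def ara (G : Grading.{u} σ) (J : Ideal (MvPolynomial σ K)) : ℕ∞ :=
  sInf {s : ℕ∞ | ∃ (n : ℕ) (F : Fin n → MvPolynomial σ K), s = n ∧
    (∀ i, G.IsHomogeneous (F i)) ∧ J.radical = (Ideal.span (Set.range F)).radical}

/-- `J` is a `𝓖`-homogeneous set-theoretic complete intersection. -/
def IsSetTheoreticCI (G : Grading.{u} σ) (J : Ideal (MvPolynomial σ K)) : Prop :=
  J.height = G.ara J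

end

universe u₁ u₂

/-- `𝓕 ≤ 𝓖`: every `𝓖`-homogeneous ideal of `K[x]` is `𝓕`-homogeneous. -/
def IsSpecialization (K : Type v) [Field K] (F : Grading.{u₁} σ) (G : Grading.{u₂} σ) : Prop :=
  ∀ J : Ideal (MvPolynomial σ K), G.IsHomogeneousIdeal J → F.IsHomogeneousIdeal J

/-- Equivalence of gradings, `𝓕 ∼ 𝓖`: they have the same homogeneous ideals in `K[x]`. -/
def equivalence (K : Type v) [Field K] (σ : Type) : Setoid (Grading.{u} σ) where
  r F G := ∀ J : Ideal (MvPolynomial σ K), F.IsHomogeneousIdeal J ↔ G.IsHomogeneousIdeal J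
  iseqv := ⟨fun _ _ => Iff.rfl, fun h J => (h J).symm, fun h h' J => (h J).trans (h' J)⟩

end Grading

/-- The lattice ideal `I_L = (x^{α₊} - x^{α₋} : α ∈ L)` of a lattice `L ⊆ ℤ^σ`. -/
noncomputable def latticeIdeal (K : Type v) [Field K] {σ : Type} [Fintype σ]
    (L : AddSubgroup (σ → ℤ)) : Ideal (MvPolynomial σ K) :=
  Ideal.span {p | ∃ α ∈ L,
    p = MvPolynomial.monomial (Finsupp.equivFunOnFinite.symm fun i => (α i).toNat) 1 -
      MvPolynomial.monomial (Finsupp.equivFunOnFinite.symm fun i => (-α i).toNat) 1}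

/-- The twelve edges of the cube graph with vertices `1, …, 8`: the top square `1-2-3-4`, the
bottom square `5-6-7-8` and the vertical edges `15, 26, 37, 48`. -/
inductive CubeEdge
  | e12 | e14 | e15 | e23 | e26 | e34 | e37 | e48 | e56 | e58 | e67 | e78
  deriving DecidableEq

namespace CubeEdge

instance : Fintype CubeEdge where
  elems := {e12, e14, e15, e23, e26, e34, e37, e48, e56, e58, e67, e78}
  complete e := by cases e <;> simp

/-- The endpoints of an edge; the vertices `1, …, 8` are written `0, …, 7`. -/
def ends : CubeEdge → Fin 8 × Fin 8
  | e12 => (0, 1)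
  | e14 => (0, 3)
  | e15 => (0, 4)
  | e23 => (1, 2)
  | e26 => (1, 5)
  | e34 => (2, 3)
  | e37 => (2, 6)
  | e48 => (3, 7)
  | e56 => (4, 5)
  | e58 => (4, 7)
  | e67 => (5, 6)
  | e78 => (6, 7)

/-- The vector configuration of the cube graph: `a_{ij} = e_i + e_j` for each edge `ij`. -/
def aVec (e : CubeEdge) : Fin 8 → ℤ := Pi.single e.ends.1 1 + Pi.single e.ends.2 1

/-- The vectors `b_{ij}` of the coarser grading. -/
def bVec : CubeEdge → Fin 4 → ℤ
  | e12 => ![5, 0, 3, 4]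
  | e14 => ![3, 1, 5, 5]
  | e15 => ![4, 1, 4, 8]
  | e23 => ![4, 0, 2, 3]
  | e26 => ![5, 0, 1, 6]
  | e34 => ![2, 1, 4, 4]
  | e37 => ![2, 1, 2, 6]
  | e48 => ![1, 2, 5, 8]
  | e56 => ![4, 1, 2, 10]
  | e58 => ![2, 2, 4, 11]
  | e67 => ![3, 1, 1, 9]
  | e78 => ![1, 2, 3, 10]

end CubeEdge

/-- The group `𝓖 = ℤA_G` of the cube graph. -/
def cubeG : Grading.{0} CubeEdge := Grading.ofVectors CubeEdge.aVec

/-- The group `𝓕 = ℤB`. -/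
def cubeF : Grading.{0} CubeEdge := Grading.ofVectors CubeEdge.bVec

/-- The toric ideal of the cube graph, as the lattice ideal of `L_𝓖`. -/
noncomputable def cubeIdeal (K : Type v) [Field K] : Ideal (MvPolynomial CubeEdge K) :=
  latticeIdeal K cubeG.relLattice

/-- The `K`-algebra homomorphism `x_{ij} ↦ t_i t_j`. -/
noncomputable def cubeHom (K : Type v) [Field K] :
    MvPolynomial CubeEdge K →ₐ[K] MvPolynomial (Fin 8) K :=
  MvPolynomial.aeval fun e => MvPolynomial.X e.ends.1 * MvPolynomial.X e.ends.2

open MvPolynomial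

/-! The chordless cycles of the cube are six squares and four hexagons; each is the union of two
perfect matchings, whose difference is a binomial. These ten binomials generate the toric ideal: two
monomials of equal vertex degree can be moved, by exchanging matchings, to monomials with a common
variable (`commonVariable_of_sameDegree`), which is cancelled by induction.

Lower bounds on the arithmetical rank come from evaluating at the indicator point of a matching. The
cycle binomial is nonzero there, so some defining polynomial `f j` is nonzero too; since a proper
part of the matching is determined by its vertex degrees, `f j` contains a monomial supported on
exactly that matching (`exists_mem_support_of_radical_eq`). Homogeneity then forces different `f j`
for matchings that the grading separates: all ten for `cubeG`, the six squares and one hexagon for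
`cubeF`.

For the upper bounds, the ten binomials serve `cubeG`. For `cubeF` all hexagons have the same
degree, and the product of two distinct hexagons lies in the ideal of the squares, so the squares
and the sum of the hexagons suffice up to radical (`radical_squaresAndHexagonSum`).

The height is at least 5 by a chain of toric primes, and at most 5 by Krull's theorem for five
squares. Arithmetical rank is monotone under specialization, so it lies between 7 and 10 for
intermediate gradings and never equals 5. Recording the degree at one vertex modulo `r` gives
infinitely many such gradings. -/

/-- Weights are compatible with additive maps. -/
theorem Finsupp.weight_map {σ M N : Type*} [AddCommMonoid M] [AddCommMonoid N] (φ : M →+ N)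
    (w : σ → M) (m : σ →₀ ℕ) :
    Finsupp.weight (fun i => φ (w i)) m = φ (Finsupp.weight w m) := by
  simp [Finsupp.weight_apply, map_finsuppSum]

/-! ### Gradings, specialization and homogeneous arithmetical rank -/

namespace Grading

universe u₁ u₂

variable {σ : Type}

theorem coe_weight_ofVectors {M : Type u} [AddCommGroup M] (b : σ → M) (m : σ →₀ ℕ) :
    ((Finsupp.weight (ofVectors b).gen m : (ofVectors b).carrier) :
      AddSubgroup.closure (Set.range b)).1 = Finsupp.weight b m :=
  (Finsupp.weight_map (AddSubgroup.closure (Set.range b)).subtype (ofVectors b).gen m).symm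

theorem weight_ofVectors_eq_iff {M : Type u} [AddCommGroup M] (b : σ → M) (m n : σ →₀ ℕ) :
    Finsupp.weight (ofVectors b).gen m = Finsupp.weight (ofVectors b).gen n ↔
      Finsupp.weight b m = Finsupp.weight b n := by
  rw [← coe_weight_ofVectors b m, ← coe_weight_ofVectors b n]
  exact Subtype.ext_iff

variable {K : Type v} [Field K]

theorem IsHomogeneous.weight_eq {G : Grading.{u} σ} {p : MvPolynomial σ K}
    (hp : G.IsHomogeneous p) {m n : σ →₀ ℕ} (hm : m ∈ p.support) (hn : n ∈ p.support) :
    Finsupp.weight G.gen m = Finsupp.weight G.gen n := by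
  obtain ⟨d, hd⟩ := hp
  rw [hd (mem_support_iff.1 hm), hd (mem_support_iff.1 hn)]

theorem IsHomogeneous.of_weight {F : Grading.{u₁} σ} {G : Grading.{u₂} σ}
    (h : ∀ m n : σ →₀ ℕ, Finsupp.weight G.gen m = Finsupp.weight G.gen n →
      Finsupp.weight F.gen m = Finsupp.weight F.gen n)
    {p : MvPolynomial σ K} (hp : G.IsHomogeneous p) : F.IsHomogeneous p := by
  rcases p.support.eq_empty_or_nonempty with h0 | ⟨m, hm⟩
  · rw [support_eq_empty.1 h0]
    exact ⟨0, isWeightedHomogeneous_zero _ _ _⟩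
  · exact ⟨Finsupp.weight F.gen m, fun n hn => h _ _ (hp.weight_eq (mem_support_iff.2 hn) hm)⟩

attribute [local instance] MvPolynomial.weightedGradedAlgebra

open scoped Classical in
theorem IsHomogeneousIdeal.component_mem {G : Grading.{u} σ} {J : Ideal (MvPolynomial σ K)}
    (hJ : G.IsHomogeneousIdeal J) {p : MvPolynomial σ K} (hp : p ∈ J) (d : G.carrier) :
    weightedHomogeneousComponent G.gen d p ∈ J := by
  obtain ⟨S, hS, rfl⟩ := hJ
  exact weightedHomogeneousComponent_mem_of_mem K G.gen
    (Ideal.homogeneous_span _ _ fun p hp => hS p hp) hp d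

/-- The principal ideal of `x^m - x^n` is the test case: if the `F`-degrees differed, homogeneity
would put the component `x^m` into the ideal, but the generator vanishes at the all-ones point and
`x^m` does not. -/
theorem isSpecialization_iff (F : Grading.{u₁} σ) (G : Grading.{u₂} σ) :
    IsSpecialization K F G ↔ ∀ m n : σ →₀ ℕ,
      Finsupp.weight G.gen m = Finsupp.weight G.gen n →
        Finsupp.weight F.gen m = Finsupp.weight F.gen n := by
  classical
  constructor
  · intro h m n hmn
    by_contra hne
    have hom : G.IsHomogeneous (monomial m (1 : K) - monomial n 1) :=
      ⟨Finsupp.weight G.gen m, (isWeightedHomogeneous_monomial _ _ _ rfl).sub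
        (isWeightedHomogeneous_monomial _ _ _ hmn.symm)⟩
    have hJ := h (Ideal.span {monomial m (1 : K) - monomial n 1}) ⟨_, by simpa using hom, rfl⟩
    have hmem := hJ.component_mem (Ideal.mem_span_singleton_self _) (Finsupp.weight F.gen m)
    rw [map_sub, (isWeightedHomogeneous_monomial F.gen m (1 : K)
      rfl).weightedHomogeneousComponent_same, (isWeightedHomogeneous_monomial F.gen n (1 : K)
      rfl).weightedHomogeneousComponent_ne _ hne, sub_zero] at hmem
    obtain ⟨q, hq⟩ := Ideal.mem_span_singleton.1 hmem
    have := congrArg (eval fun _ => (1 : K)) hq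
    simp [eval_monomial] at this
  · rintro h J ⟨S, hS, rfl⟩
    exact ⟨S, fun p hp => (hS p hp).of_weight h, rfl⟩

theorem IsSpecialization.isHomogeneous {F : Grading.{u₁} σ} {G : Grading.{u₂} σ}
    (h : IsSpecialization K F G) {p : MvPolynomial σ K} (hp : G.IsHomogeneous p) :
    F.IsHomogeneous p :=
  hp.of_weight ((isSpecialization_iff F G).1 h)

theorem IsSpecialization.ara_le {F : Grading.{u₁} σ} {G : Grading.{u₂} σ}
    (h : IsSpecialization K F G) (J : Ideal (MvPolynomial σ K)) : F.ara J ≤ G.ara J := by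
  refine sInf_le_sInf ?_
  rintro s ⟨n, f, hs, hf, hJ⟩
  exact ⟨n, f, hs, fun i => h.isHomogeneous (hf i), hJ⟩

theorem ara_le {G : Grading.{u} σ} {J : Ideal (MvPolynomial σ K)} {n : ℕ}
    (f : Fin n → MvPolynomial σ K) (hf : ∀ i, G.IsHomogeneous (f i))
    (hJ : J.radical = (Ideal.span (Set.range f)).radical) : G.ara J ≤ n :=
  sInf_le ⟨n, f, rfl, hf, hJ⟩

theorem le_ara {G : Grading.{u} σ} {J : Ideal (MvPolynomial σ K)} {k : ℕ}
    (h : ∀ (n : ℕ) (f : Fin n → MvPolynomial σ K), (∀ i, G.IsHomogeneous (f i)) →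
      J.radical = (Ideal.span (Set.range f)).radical → k ≤ n) : (k : ℕ∞) ≤ G.ara J := by
  refine le_sInf ?_
  rintro s ⟨n, f, rfl, hf, hJ⟩
  exact_mod_cast h n f hf hJ

theorem deg_sub_eq_zero_iff [Fintype σ] (G : Grading.{u} σ) (m n : σ →₀ ℕ) :
    (fun i => (m i : ℤ) - n i) ∈ G.relLattice ↔
      Finsupp.weight G.gen m = Finsupp.weight G.gen n := by
  have h (m : σ →₀ ℕ) : Finsupp.weight G.gen m = ∑ i, (m i : ℤ) • G.gen i := by
    rw [Finsupp.weight_apply, Finsupp.sum_fintype _ _ (by simp)]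
    simp
  rw [relLattice, AddMonoidHom.mem_ker, h, h, ← sub_eq_zero (b := ∑ i, (n i : ℤ) • G.gen i),
    ← Finset.sum_sub_distrib]
  simp [deg, sub_smul]

end Grading

/-! ### Congruence of monomials modulo an ideal -/

section MonomialCongr

variable {K : Type v} [Field K] {σ : Type} {J : Ideal (MvPolynomial σ K)}

/-- The monomials with exponents `m` and `n` are congruent modulo `J`. -/
def MonomialCongr (J : Ideal (MvPolynomial σ K)) (m n : σ →₀ ℕ) : Prop :=
  monomial m (1 : K) - monomial n 1 ∈ J

namespace MonomialCongr

theorem refl (m : σ →₀ ℕ) : MonomialCongr J m m := by simp [MonomialCongr]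

theorem symm {m n : σ →₀ ℕ} (h : MonomialCongr J m n) : MonomialCongr J n m := by
  simpa [MonomialCongr] using J.neg_mem h

theorem trans {m n k : σ →₀ ℕ} (h : MonomialCongr J m n) (h' : MonomialCongr J n k) :
    MonomialCongr J m k := by
  simpa [MonomialCongr] using J.add_mem h h'

theorem add_left {m n : σ →₀ ℕ} (h : MonomialCongr J m n) (k : σ →₀ ℕ) :
    MonomialCongr J (k + m) (k + n) := by
  simpa [MonomialCongr, mul_sub, monomial_mul] using J.mul_mem_left (monomial k 1) h

end MonomialCongr

/-- The exponent vector of the squarefree monomial with support `s`. -/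
noncomputable def squarefreeExponent (s : Finset σ) : σ →₀ ℕ := ∑ e ∈ s, Finsupp.single e 1

theorem squarefreeExponent_apply [DecidableEq σ] (s : Finset σ) (e : σ) :
    squarefreeExponent s e = if e ∈ s then 1 else 0 := by
  simp [squarefreeExponent, Finsupp.finsetSum_apply, Finsupp.single_apply]

theorem monomial_squarefreeExponent (s : Finset σ) :
    monomial (squarefreeExponent s) (1 : K) = ∏ e ∈ s, X e := by
  simp [squarefreeExponent, monomial_sum_one, X]

/-- A relation between squarefree monomials can be applied to every multiple of its left side. -/
theorem MonomialCongr.exists_move {s t : Finset σ}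
    (h : MonomialCongr J (squarefreeExponent s) (squarefreeExponent t)) {m : σ →₀ ℕ}
    (hm : ∀ e ∈ s, 0 < m e) : ∃ m', MonomialCongr J m m' ∧ ∀ e ∈ t, 0 < m' e := by
  classical
  have hle : squarefreeExponent s ≤ m := fun e => by
    rw [squarefreeExponent_apply]
    split_ifs with he
    exacts [hm e he, Nat.zero_le _]
  refine ⟨m - squarefreeExponent s + squarefreeExponent t, ?_, fun e he => ?_⟩
  · have := h.add_left (m - squarefreeExponent s)
    rwa [tsub_add_cancel_of_le hle] at this
  · simp [squarefreeExponent_apply, he]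

/-- Modulo `J`, the two monomials are congruent to monomials with a common variable. -/
def CommonVariable (J : Ideal (MvPolynomial σ K)) (m n : σ →₀ ℕ) : Prop :=
  ∃ m' n' e, MonomialCongr J m m' ∧ MonomialCongr J n n' ∧ 0 < m' e ∧ 0 < n' e

theorem CommonVariable.symm {m n : σ →₀ ℕ} (h : CommonVariable J m n) : CommonVariable J n m := by
  obtain ⟨m', n', e, h₁, h₂, h₃, h₄⟩ := h
  exact ⟨n', m', e, h₂, h₁, h₄, h₃⟩

theorem CommonVariable.of_pos {m n : σ →₀ ℕ} (e : σ) (hm : 0 < m e) (hn : 0 < n e) :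
    CommonVariable J m n :=
  ⟨m, n, e, .refl _, .refl _, hm, hn⟩

theorem CommonVariable.of_left {m n : σ →₀ ℕ} {s t : Finset σ}
    (h : MonomialCongr J (squarefreeExponent s) (squarefreeExponent t)) (hm : ∀ e ∈ s, 0 < m e)
    (e : σ) (he : e ∈ t) (hn : 0 < n e) : CommonVariable J m n := by
  obtain ⟨m', h₁, h₂⟩ := h.exists_move hm
  exact ⟨m', n, e, h₁, .refl _, h₂ e he, hn⟩

/-- The local step at a vertex `p` of the cube, with edges `a = pq`, `b = ps` and `c = pt`: the
edges at `q` are `a, b', d`, those at `s` are `b, a', d'`, the third edges `d` and `d'` end in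
vertices with edges `d, f, g` and `d', f', g'`. -/
theorem CommonVariable.of_adjacent_edges [DecidableEq σ] {m n : σ →₀ ℕ}
    (a b c a' b' d d' f f' g g' : σ)
    (hab : MonomialCongr J (squarefreeExponent {a, a'}) (squarefreeExponent {b, b'}))
    (hac : MonomialCongr J (squarefreeExponent {a, f}) (squarefreeExponent {c, d}))
    (hbc : MonomialCongr J (squarefreeExponent {b, f'}) (squarefreeExponent {c, d'}))
    (hhex : MonomialCongr J (squarefreeExponent {a, d', g}) (squarefreeExponent {b, d, g'}))
    (hq : m a + m b' + m d = n a + n b' + n d) (hs : m b + m a' + m d' = n b + n a' + n d')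
    (hw : m d + m f + m g = n d + n f + n g) (hz : m d' + m f' + m g' = n d' + n f' + n g')
    (ha : 0 < m a) (hb : 0 < n b) : CommonVariable J m n := by
  -- A vertex covered by one monomial is covered by the other. At each vertex, every edge but the
  -- third one either is already shared or allows a square move that creates a shared variable. What
  -- is left is a matching `a, d', g` of a hexagon inside `m`, and the hexagon move produces `b`.
  have hq' : 0 < n a ∨ 0 < n b' ∨ 0 < n d := by omega
  have hs' : 0 < m b ∨ 0 < m a' ∨ 0 < m d' := by omega
  rcases hq' with h | h | hd
  · exact .of_pos a ha h
  · exact (CommonVariable.of_left hab.symm (by simp [hb, h]) a (by simp) ha).symm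
  rcases hs' with h | h | hd'
  · exact .of_pos b h hb
  · exact .of_left hab (by simp [ha, h]) b (by simp) hb
  have hw' : 0 < m d ∨ 0 < m f ∨ 0 < m g := by omega
  have hz' : 0 < n d' ∨ 0 < n f' ∨ 0 < n g' := by omega
  rcases hw' with h | h | hg
  · exact .of_pos d h hd
  · exact .of_left hac (by simp [ha, h]) d (by simp) hd
  rcases hz' with h | h | hg'
  · exact .of_pos d' hd' h
  · exact (CommonVariable.of_left hbc (by simp [hb, h]) d' (by simp) hd').symm
  exact .of_left hhex (by simp [ha, hd', hg]) b (by simp) hb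

end MonomialCongr

/-! ### The chordless cycles generate the toric ideal -/

namespace CubeEdge

/-- The chordless cycles of the cube, each split into two perfect matchings: this is the first one.
The indices `0, …, 5` are the squares, `6, …, 9` the hexagons. -/
def cyclePos : Fin 10 → Finset CubeEdge :=
  ![{e12, e34}, {e12, e56}, {e23, e67}, {e34, e78}, {e14, e58}, {e56, e78},
    {e23, e48, e56}, {e14, e37, e56}, {e12, e48, e67}, {e12, e37, e58}]

/-- The second perfect matching of each chordless cycle of the cube. -/
def cycleNeg : Fin 10 → Finset CubeEdge :=
  ![{e14, e23}, {e15, e26}, {e26, e37}, {e37, e48}, {e15, e48}, {e58, e67},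
    {e26, e34, e58}, {e15, e34, e67}, {e14, e26, e78}, {e15, e23, e78}]

/-- The binomial of a chordless cycle of the cube. -/
noncomputable def cycleBinomial (K : Type v) [Field K] (i : Fin 10) : MvPolynomial CubeEdge K :=
  ∏ e ∈ cyclePos i, X e - ∏ e ∈ cycleNeg i, X e

/-- The ideal of the chordless cycles of the cube. -/
noncomputable def cycleIdeal (K : Type v) [Field K] : Ideal (MvPolynomial CubeEdge K) :=
  Ideal.span (Set.range (cycleBinomial K))

/-- `s` and `t` are the two perfect matchings of a chordless cycle. -/
def AreMatchings (s t : Finset CubeEdge) : Prop :=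
  ∃ i, s = cyclePos i ∧ t = cycleNeg i ∨ t = cyclePos i ∧ s = cycleNeg i

instance (s t : Finset CubeEdge) : Decidable (AreMatchings s t) := by
  unfold AreMatchings
  infer_instance

variable {K : Type v} [Field K]

theorem cycleBinomial_mem (i : Fin 10) : cycleBinomial K i ∈ cycleIdeal K :=
  Ideal.subset_span ⟨i, rfl⟩

theorem AreMatchings.monomialCongr {s t : Finset CubeEdge} (h : AreMatchings s t) :
    MonomialCongr (cycleIdeal K) (squarefreeExponent s) (squarefreeExponent t) := by
  have key (i) : MonomialCongr (cycleIdeal K) (squarefreeExponent (cyclePos i))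
      (squarefreeExponent (cycleNeg i)) := by
    rw [MonomialCongr, monomial_squarefreeExponent, monomial_squarefreeExponent]
    exact cycleBinomial_mem i
  obtain ⟨i, ⟨rfl, rfl⟩ | ⟨rfl, rfl⟩⟩ := h
  exacts [key i, (key i).symm]

/-- Equality of the vertex degrees of two edge weightings. -/
structure SameDegree (m n : CubeEdge → ℕ) : Prop where
  at1 : m e12 + m e14 + m e15 = n e12 + n e14 + n e15
  at2 : m e12 + m e23 + m e26 = n e12 + n e23 + n e26
  at3 : m e23 + m e34 + m e37 = n e23 + n e34 + n e37
  at4 : m e14 + m e34 + m e48 = n e14 + n e34 + n e48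
  at5 : m e15 + m e56 + m e58 = n e15 + n e56 + n e58
  at6 : m e26 + m e56 + m e67 = n e26 + n e56 + n e67
  at7 : m e37 + m e67 + m e78 = n e37 + n e67 + n e78
  at8 : m e48 + m e58 + m e78 = n e48 + n e58 + n e78

/-- The step at the vertex `1`, transported along a symmetry `π` of the cube. -/
theorem commonVariable_of_symmetry (π : CubeEdge → CubeEdge)
    (hπ : ∀ i, AreMatchings ((cyclePos i).image π) ((cycleNeg i).image π)) {m n : CubeEdge →₀ ℕ}
    (h : SameDegree (fun e => m (π e)) (fun e => n (π e)))
    (h0 : m (π e12) + m (π e14) + m (π e15) ≠ 0) : CommonVariable (cycleIdeal K) m n := by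
  have c (i) := (hπ i).monomialCongr (K := K)
  have c0 := c 0
  have c1 := c 1
  have c4 := c 4
  have c7 := c 7
  have c8 := c 8
  have c9 := c 9
  simp only [cyclePos, cycleNeg, Fin.isValue, Matrix.cons_val, Finset.image_insert,
    Finset.image_singleton] at c0 c1 c4 c7 c8 c9
  obtain ⟨h1, h2, h3, h4, h5, h6, h7, h8⟩ := h
  have hm : 0 < m (π e12) ∨ 0 < m (π e14) ∨ 0 < m (π e15) := by omega
  have hn : 0 < n (π e12) ∨ 0 < n (π e14) ∨ 0 < n (π e15) := by omega
  have s24 (m n : CubeEdge →₀ ℕ) := CommonVariable.of_adjacent_edges (m := m) (n := n)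
    (π e12) (π e14) (π e15) (π e34) (π e23) (π e26) (π e48) (π e56) (π e58) (π e67) (π e78)
    c0 c1 c4 c8
  have s25 (m n : CubeEdge →₀ ℕ) := CommonVariable.of_adjacent_edges (m := m) (n := n)
    (π e12) (π e15) (π e14) (π e56) (π e26) (π e23) (π e58) (π e34) (π e48) (π e37) (π e78)
    c1 c0 (by simpa only [Finset.pair_comm] using c4.symm)
    (by simpa only [Finset.pair_comm] using c9)
  have s45 (m n : CubeEdge →₀ ℕ) := CommonVariable.of_adjacent_edges (m := m) (n := n)
    (π e14) (π e15) (π e12) (π e58) (π e48) (π e34) (π e56) (π e23) (π e26) (π e37) (π e67)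
    c4 c0.symm (by simpa only [Finset.pair_comm] using c1.symm)
    (by simpa only [Finset.pair_comm] using c7)
  rcases hm with hm | hm | hm <;> rcases hn with hn | hn | hn
  · exact .of_pos _ hm hn
  · exact s24 m n (by omega) (by omega) (by omega) (by omega) hm hn
  · exact s25 m n (by omega) (by omega) (by omega) (by omega) hm hn
  · exact (s24 n m (by omega) (by omega) (by omega) (by omega) hn hm).symm
  · exact .of_pos _ hm hn
  · exact s45 m n (by omega) (by omega) (by omega) (by omega) hm hn
  · exact (s25 n m (by omega) (by omega) (by omega) (by omega) hn hm).symm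
  · exact (s45 n m (by omega) (by omega) (by omega) (by omega) hn hm).symm
  · exact .of_pos _ hm hn

end CubeEdge

/-- A monomial map with monomial values sends monomials to monomials. -/
theorem MvPolynomial.aeval_monomial_weight {K σ τ : Type*} [CommSemiring K]
    (w : σ → τ →₀ ℕ) (m : σ →₀ ℕ) (c : K) :
    aeval (fun i => monomial (w i) (1 : K)) (monomial m c) =
      monomial (Finsupp.weight w m) c := by
  rw [aeval_monomial, Finsupp.weight_apply, algebraMap_eq, Finsupp.prod, Finsupp.sum]
  simp only [monomial_pow, one_pow]
  rw [← monomial_sum_one, C_mul_monomial, mul_one]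

namespace CubeEdge

theorem sum_univ {M : Type*} [AddCommMonoid M] (f : CubeEdge → M) :
    ∑ e, f e = f e12 + f e14 + f e15 + f e23 + f e26 + f e34 + f e37 + f e48 + f e56 + f e58 +
      f e67 + f e78 := by
  change ∑ e ∈ {e12, e14, e15, e23, e26, e34, e37, e48, e56, e58, e67, e78}, f e = _
  simp [Finset.sum_insert, add_assoc]

/-- The vertex degrees of an edge weighting. -/
noncomputable def vertexDegree : (CubeEdge →₀ ℕ) →+ (Fin 8 →₀ ℕ) :=
  Finsupp.weight fun e => Finsupp.single e.ends.1 1 + Finsupp.single e.ends.2 1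

theorem vertexDegree_single (e : CubeEdge) (k : ℕ) : vertexDegree (Finsupp.single e k) =
    Finsupp.single e.ends.1 k + Finsupp.single e.ends.2 k := by
  simp [vertexDegree, Finsupp.weight_single, smul_add]

theorem vertexDegree_apply (m : CubeEdge →₀ ℕ) (k : Fin 8) :
    vertexDegree m k = ∑ e, m e * (Finsupp.single e.ends.1 1 k + Finsupp.single e.ends.2 1 k) := by
  rw [vertexDegree, Finsupp.weight_apply, Finsupp.sum_fintype _ _ (by simp),
    Finsupp.finsetSum_apply]
  simp [Finsupp.single_apply, mul_add]

theorem vertexDegree_eq_iff (m n : CubeEdge →₀ ℕ) :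
    vertexDegree m = vertexDegree n ↔ SameDegree m n := by
  have key : vertexDegree m = vertexDegree n ↔ ∀ k, vertexDegree m k = vertexDegree n k :=
    DFunLike.ext_iff
  simp only [key, Fin.forall_fin_succ, vertexDegree_apply, sum_univ, ends, Finsupp.single_apply]
  simp
  constructor
  · rintro ⟨h1, h2, h3, h4, h5, h6, h7, h8⟩
    constructor <;> assumption
  · rintro ⟨h1, h2, h3, h4, h5, h6, h7, h8⟩
    exact ⟨h1, h2, h3, h4, h5, h6, h7, h8⟩

variable {K : Type v} [Field K]

theorem cubeHom_monomial (m : CubeEdge →₀ ℕ) (c : K) :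
    cubeHom K (monomial m c) = monomial (vertexDegree m) c := by
  have : (fun e : CubeEdge => (X e.ends.1 * X e.ends.2 : MvPolynomial (Fin 8) K)) =
      fun e => monomial (Finsupp.single e.ends.1 1 + Finsupp.single e.ends.2 1) 1 := by
    ext1 e
    simp [X, monomial_mul]
  rw [cubeHom, this, aeval_monomial_weight]
  rfl

theorem weight_aVec_eq_iff (m n : CubeEdge →₀ ℕ) :
    Finsupp.weight aVec m = Finsupp.weight aVec n ↔ vertexDegree m = vertexDegree n := by
  let φ : (Fin 8 →₀ ℕ) →+ (Fin 8 → ℤ) :=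
    { toFun := fun d k => d k, map_zero' := by ext; simp, map_add' := by intros; ext; simp }
  have hφ : Function.Injective φ := fun d d' h => by
    ext k
    exact Nat.cast_injective (R := ℤ) (congrFun h k)
  have h (m : CubeEdge →₀ ℕ) : Finsupp.weight aVec m = φ (vertexDegree m) := by
    rw [vertexDegree, ← Finsupp.weight_map]
    congr 2
    ext e k
    simp [φ, aVec, Finsupp.single_apply, Pi.single_apply, eq_comm]
  rw [h, h, hφ.eq_iff]

theorem sum_aVec_cyclePos (i : Fin 10) :
    ∑ e ∈ cyclePos i, aVec e = ∑ e ∈ cycleNeg i, aVec e := by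
  revert i
  decide

theorem vertexDegree_cyclePos (i : Fin 10) :
    vertexDegree (squarefreeExponent (cyclePos i)) =
      vertexDegree (squarefreeExponent (cycleNeg i)) := by
  rw [← weight_aVec_eq_iff]
  simpa [squarefreeExponent, map_sum, Finsupp.weight_single] using sum_aVec_cyclePos i

theorem cycleBinomial_eq (i : Fin 10) : cycleBinomial K i =
    monomial (squarefreeExponent (cyclePos i)) 1 -
      monomial (squarefreeExponent (cycleNeg i)) 1 := by
  simp [cycleBinomial, monomial_squarefreeExponent]

theorem cycleIdeal_le_ker : cycleIdeal K ≤ RingHom.ker (cubeHom K) := by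
  rw [cycleIdeal, Ideal.span_le]
  rintro _ ⟨i, rfl⟩
  rw [SetLike.mem_coe, RingHom.mem_ker, cycleBinomial_eq, map_sub, cubeHom_monomial,
    cubeHom_monomial, vertexDegree_cyclePos, sub_self]

theorem vertexDegree_eq_of_monomialCongr {m n : CubeEdge →₀ ℕ}
    (h : MonomialCongr (cycleIdeal K) m n) : vertexDegree m = vertexDegree n := by
  have hmem := cycleIdeal_le_ker h
  rw [RingHom.mem_ker, map_sub, cubeHom_monomial, cubeHom_monomial, sub_eq_zero] at hmem
  exact monomial_left_injective (one_ne_zero (α := K)) hmem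

/-- The half turn of the cube exchanging the vertices `1` and `3`. -/
def halfTurn13 : CubeEdge → CubeEdge
  | e12 => e34 | e14 => e23 | e15 => e37 | e23 => e14 | e26 => e48 | e34 => e12
  | e37 => e15 | e48 => e26 | e56 => e78 | e58 => e67 | e67 => e58 | e78 => e56

/-- The half turn of the cube exchanging the vertices `1` and `6`. -/
def halfTurn16 : CubeEdge → CubeEdge
  | e12 => e56 | e14 => e67 | e15 => e26 | e23 => e58 | e26 => e15 | e34 => e78
  | e37 => e48 | e48 => e37 | e56 => e12 | e58 => e23 | e67 => e14 | e78 => e34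

/-- The half turn of the cube exchanging the vertices `1` and `8`. -/
def halfTurn18 : CubeEdge → CubeEdge
  | e12 => e78 | e14 => e58 | e15 => e48 | e23 => e67 | e26 => e37 | e34 => e56
  | e37 => e26 | e48 => e15 | e56 => e34 | e58 => e14 | e67 => e23 | e78 => e12

/-- The vertices 1, 3, 6, 8 form one class of the bipartition, so every edge has an end among them
and a nonzero `m` covers one of them. The half turns carry the vertex 1 to the other three. -/
theorem commonVariable_of_sameDegree {m n : CubeEdge →₀ ℕ} (h : SameDegree m n) (h0 : m ≠ 0) :
    CommonVariable (cycleIdeal K) m n := by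
  have hcases : m e12 + m e14 + m e15 ≠ 0 ∨ m e34 + m e23 + m e37 ≠ 0 ∨
      m e56 + m e67 + m e26 ≠ 0 ∨ m e78 + m e58 + m e48 ≠ 0 := by
    by_contra hc
    refine h0 (Finsupp.ext fun e => ?_)
    cases e <;> simp only [Finsupp.coe_zero, Pi.zero_apply] <;> omega
  have h' := h
  obtain ⟨h1, h2, h3, h4, h5, h6, h7, h8⟩ := h'
  rcases hcases with hc | hc | hc | hc
  · exact commonVariable_of_symmetry id (by decide) h hc
  · exact commonVariable_of_symmetry halfTurn13 (by decide)
      (by constructor <;> simp only [halfTurn13] <;> omega) hc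
  · exact commonVariable_of_symmetry halfTurn16 (by decide)
      (by constructor <;> simp only [halfTurn16] <;> omega) hc
  · exact commonVariable_of_symmetry halfTurn18 (by decide)
      (by constructor <;> simp only [halfTurn18] <;> omega) hc

/-- The induction runs on the total vertex degree because moves preserve it, while cancelling a
common variable lowers it by 2. -/
theorem monomialCongr_of_vertexDegree_eq (m n : CubeEdge →₀ ℕ)
    (h : vertexDegree m = vertexDegree n) : MonomialCongr (cycleIdeal K) m n := by
  induction hN : (vertexDegree m).degree using Nat.strong_induction_on generalizing m n with
  | _ N ih =>
  subst hN
  by_cases h0 : m = 0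
  · have hn : n = 0 := by
      subst h0
      rw [vertexDegree_eq_iff] at h
      obtain ⟨h1, h2, h3, h4, h5, h6, h7, h8⟩ := h
      simp only [Finsupp.coe_zero, Pi.zero_apply] at h1 h2 h3 h4 h5 h6 h7 h8
      refine Finsupp.ext fun e => ?_
      cases e <;> simp only [Finsupp.coe_zero, Pi.zero_apply] <;> omega
    rw [h0, hn]
    exact .refl _
  · obtain ⟨m', n', e, hm, hn, hme, hne⟩ :=
      commonVariable_of_sameDegree (K := K) ((vertexDegree_eq_iff m n).1 h) h0
    have split {k : CubeEdge →₀ ℕ} (hk : 0 < k e) :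
        ∃ k', k = Finsupp.single e 1 + k' :=
      ⟨k - Finsupp.single e 1, by
        rw [add_tsub_cancel_of_le]
        exact Finsupp.single_le_iff.2 hk⟩
    obtain ⟨m'', rfl⟩ := split hme
    obtain ⟨n'', rfl⟩ := split hne
    have dm := vertexDegree_eq_of_monomialCongr hm
    have dn := vertexDegree_eq_of_monomialCongr hn
    have heq : vertexDegree m'' = vertexDegree n'' := by
      have := dm.symm.trans (h.trans dn)
      rwa [map_add, map_add, add_right_inj] at this
    have hlt : (vertexDegree m'').degree < (vertexDegree m).degree := by
      rw [dm, map_add, map_add, vertexDegree_single, map_add]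
      simp
    exact hm.trans (((ih _ hlt m'' n'' heq rfl).add_left _).trans hn.symm)

/-- A linear map `s` sends `t^d` to the class of any monomial of vertex degree `d`; that class does
not depend on the choice, so `s` after `cubeHom` is the quotient map. The junk values of
`Function.invFun` outside the image play no role. -/
theorem ker_le_cycleIdeal : RingHom.ker (cubeHom K) ≤ cycleIdeal K := by
  classical
  let s : MvPolynomial (Fin 8) K →ₗ[K] MvPolynomial CubeEdge K ⧸ cycleIdeal K :=
    (basisMonomials (Fin 8) K).constr K fun d =>
      Ideal.Quotient.mk (cycleIdeal K) (monomial (Function.invFun vertexDegree d) 1)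
  have hs : s ∘ₗ (cubeHom K).toLinearMap = (Ideal.Quotient.mkₐ K (cycleIdeal K)).toLinearMap := by
    refine (basisMonomials CubeEdge K).ext fun m => ?_
    have hb : monomial (vertexDegree m) (1 : K) = basisMonomials (Fin 8) K (vertexDegree m) := by
      simp
    simp only [LinearMap.comp_apply, AlgHom.toLinearMap_apply, coe_basisMonomials,
      cubeHom_monomial]
    rw [hb, Module.Basis.constr_basis, Ideal.Quotient.mkₐ_eq_mk, Ideal.Quotient.eq]
    exact monomialCongr_of_vertexDegree_eq _ _ (Function.invFun_eq ⟨m, rfl⟩)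
  intro p hp
  rw [← Ideal.Quotient.eq_zero_iff_mem, ← Ideal.Quotient.mkₐ_eq_mk K, ← AlgHom.toLinearMap_apply,
    ← hs, LinearMap.comp_apply, AlgHom.toLinearMap_apply, RingHom.mem_ker.1 hp, map_zero]

theorem cycleIdeal_eq_ker : cycleIdeal K = RingHom.ker (cubeHom K) :=
  le_antisymm cycleIdeal_le_ker ker_le_cycleIdeal

theorem weight_cubeG_eq_iff (m n : CubeEdge →₀ ℕ) :
    Finsupp.weight cubeG.gen m = Finsupp.weight cubeG.gen n ↔ vertexDegree m = vertexDegree n :=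
  (Grading.weight_ofVectors_eq_iff _ _ _).trans (weight_aVec_eq_iff _ _)

theorem cubeIdeal_eq_ker : cubeIdeal K = RingHom.ker (cubeHom K) := by
  apply le_antisymm
  · rw [cubeIdeal, latticeIdeal, Ideal.span_le]
    rintro _ ⟨α, hα, rfl⟩
    rw [SetLike.mem_coe, RingHom.mem_ker, map_sub, cubeHom_monomial, cubeHom_monomial,
      sub_eq_zero]
    refine congrArg (monomial · 1) ?_
    rw [← weight_cubeG_eq_iff, ← Grading.deg_sub_eq_zero_iff]
    convert hα using 2 with e
    simp
  · rw [← cycleIdeal_eq_ker, cycleIdeal, Ideal.span_le]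
    rintro _ ⟨i, rfl⟩
    refine Ideal.subset_span ⟨fun e => (squarefreeExponent (cyclePos i) e : ℤ) -
      squarefreeExponent (cycleNeg i) e, ?_, ?_⟩
    · rw [Grading.deg_sub_eq_zero_iff, weight_cubeG_eq_iff, vertexDegree_cyclePos]
    -- Disjointness makes the two matchings the positive and negative parts of their difference.
    · have hdisj : Disjoint (cyclePos i) (cycleNeg i) := by
        revert i
        decide
      rw [cycleBinomial_eq]
      congr 2 <;> congr 1 <;> ext e <;> have he : e ∈ cyclePos i → e ∉ cycleNeg i :=
          fun h => Finset.disjoint_left.1 hdisj h <;>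
        by_cases h1 : e ∈ cyclePos i <;> by_cases h2 : e ∈ cycleNeg i <;>
        simp_all [squarefreeExponent_apply]

theorem cubeIdeal_eq_cycleIdeal : cubeIdeal K = cycleIdeal K :=
  cubeIdeal_eq_ker.trans cycleIdeal_eq_ker.symm

theorem cubeIdeal_isPrime : (cubeIdeal K).IsPrime := by
  rw [cubeIdeal_eq_ker]
  exact RingHom.ker_isPrime _

end CubeEdge

/-! ### Lower bounds for the arithmetical ranks -/

namespace CubeEdge

/-- A monomial alone in its vertex degree could not cancel in the image of `p`. -/
theorem exists_vertexDegree_eq {K : Type v} [Field K] {p : MvPolynomial CubeEdge K}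
    (hp : cubeHom K p = 0) {m : CubeEdge →₀ ℕ} (hm : m ∈ p.support) :
    ∃ n ∈ p.support, n ≠ m ∧ vertexDegree n = vertexDegree m := by
  classical
  by_contra! h
  have hc := congrArg (coeff (vertexDegree m)) hp
  conv_lhs at hc => rw [p.as_sum, map_sum, coeff_sum]
  rw [Finset.sum_eq_single_of_mem m hm fun n hn hne => by
    rw [cubeHom_monomial, coeff_monomial, if_neg (h n hn hne)], cubeHom_monomial, coeff_monomial,
    if_pos rfl, coeff_zero] at hc
  exact mem_support_iff.1 hm hc

/-- The edges at a vertex. -/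
def star (k : Fin 8) : Finset CubeEdge := Finset.univ.filter fun e => e.ends.1 = k ∨ e.ends.2 = k

theorem mem_star {e : CubeEdge} {k : Fin 8} : e ∈ star k ↔ e.ends.1 = k ∨ e.ends.2 = k := by
  simp [star]

theorem vertexDegree_eq_sum_star (m : CubeEdge →₀ ℕ) (k : Fin 8) :
    vertexDegree m k = ∑ e ∈ star k, m e := by
  rw [vertexDegree_apply, star, Finset.sum_filter]
  refine Finset.sum_congr rfl fun e _ => ?_
  have hne : e.ends.1 ≠ e.ends.2 := by cases e <;> decide
  by_cases h1 : e.ends.1 = k <;> by_cases h2 : e.ends.2 = k <;>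
    simp_all

/-- An edge is isolated by `s` if one of its endpoints is not covered by `s`. -/
def IsIsolated (s : Finset CubeEdge) (f : CubeEdge) : Prop :=
  ∃ k, f ∈ star k ∧ ∀ e ∈ star k, e ∉ s

instance (s : Finset CubeEdge) : DecidablePred (IsIsolated s) := fun f => by
  unfold IsIsolated
  infer_instance

/-- An edge is a leaf with respect to `s` if at one of its endpoints all other edges are
isolated. -/
def IsLeaf (s : Finset CubeEdge) (f : CubeEdge) : Prop :=
  ∃ k, f ∈ star k ∧ ∀ e ∈ star k, e ≠ f → IsIsolated s e

instance (s : Finset CubeEdge) : DecidablePred (IsLeaf s) := fun f => by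
  unfold IsLeaf
  infer_instance

/-- A finite check that three rounds of peeling, starting at the vertices left uncovered when `e` is
removed, reach every edge. Each round fixes the value on an edge from the degree at one endpoint. -/
theorem exists_mem_star_isLeaf (i : Fin 10) (e : CubeEdge) (he : e ∈ cyclePos i) (f : CubeEdge) :
    ∃ k, f ∈ star k ∧ ∀ e' ∈ star k, e' ≠ f →
      IsIsolated ((cyclePos i).erase e) e' ∨ IsLeaf ((cyclePos i).erase e) e' := by
  revert i e f
  decide +kernel

theorem apply_eq_of_star {m n : CubeEdge →₀ ℕ} (h : vertexDegree m = vertexDegree n) {k : Fin 8}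
    {f : CubeEdge} (hf : f ∈ star k) (hk : ∀ e ∈ star k, e ≠ f → n e = m e) : n f = m f := by
  have hdeg := DFunLike.congr_fun h k
  rw [vertexDegree_eq_sum_star, vertexDegree_eq_sum_star, ← Finset.add_sum_erase _ _ hf,
    ← Finset.add_sum_erase _ _ hf, Finset.sum_congr rfl fun e he =>
      hk e (Finset.mem_of_mem_erase he) (Finset.ne_of_mem_erase he)] at hdeg
  exact (Nat.add_right_cancel hdeg).symm

/-- A proper part of a perfect matching of a chordless cycle is determined by its vertex
degrees. -/
theorem eq_of_vertexDegree_eq_of_support_subset {i : Fin 10} {m n : CubeEdge →₀ ℕ}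
    {e : CubeEdge} (he : e ∈ cyclePos i) (hm : m.support ⊆ (cyclePos i).erase e)
    (h : vertexDegree m = vertexDegree n) : n = m := by
  have isolated {f} (hf : IsIsolated ((cyclePos i).erase e) f) : n f = m f := by
    obtain ⟨k, hfk, hk⟩ := hf
    have hm0 : ∀ e' ∈ star k, m e' = 0 := fun e' he' =>
      Finsupp.notMem_support_iff.1 fun h' => hk e' he' (hm h')
    have h' := DFunLike.congr_fun h k
    rw [vertexDegree_eq_sum_star, vertexDegree_eq_sum_star, Finset.sum_eq_zero hm0, eq_comm,
      Finset.sum_eq_zero_iff] at h'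
    rw [h' f hfk, hm0 f hfk]
  have leaf {f} (hf : IsLeaf ((cyclePos i).erase e) f) : n f = m f := by
    obtain ⟨k, hfk, hk⟩ := hf
    exact apply_eq_of_star h hfk fun e' he' hne => isolated (hk e' he' hne)
  refine Finsupp.ext fun f => ?_
  obtain ⟨k, hfk, hk⟩ := exists_mem_star_isLeaf i e he f
  exact apply_eq_of_star h hfk fun e' he' hne => (hk e' he' hne).elim isolated leaf

variable {K : Type v} [Field K]

/-- Only monomials supported inside the matching survive the evaluation, and one supported on a
proper part would be alone in its vertex degree. -/
theorem exists_support_eq_cyclePos {p : MvPolynomial CubeEdge K} (hp : cubeHom K p = 0)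
    {i : Fin 10} (hi : eval (fun e => if e ∈ cyclePos i then 1 else 0) p ≠ 0) :
    ∃ m ∈ p.support, m.support = cyclePos i := by
  rw [eval_eq'] at hi
  obtain ⟨m, hm, hne⟩ := Finset.exists_ne_zero_of_sum_ne_zero hi
  have hsub : m.support ⊆ cyclePos i := fun e he => by
    by_contra hc
    refine hne (mul_eq_zero_of_right _ (Finset.prod_eq_zero (Finset.mem_univ e) ?_))
    simp [hc, Finsupp.mem_support_iff.1 he]
  refine ⟨m, hm, hsub.antisymm fun e he => ?_⟩
  by_contra hc
  obtain ⟨n, -, hne, hdeg⟩ := exists_vertexDegree_eq hp hm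
  exact hne (eq_of_vertexDegree_eq_of_support_subset he (Finset.subset_erase.2 ⟨hsub, hc⟩)
    hdeg.symm)

/-- If polynomials define the cube ideal up to radical, then for every chordless cycle one of them
contains a monomial supported on the first perfect matching of the cycle. -/
theorem exists_mem_support_of_radical_eq {n : ℕ} {f : Fin n → MvPolynomial CubeEdge K}
    (hf : (cubeIdeal K).radical = (Ideal.span (Set.range f)).radical) (i : Fin 10) :
    ∃ j, ∃ m ∈ (f j).support, m.support = cyclePos i := by
  have hrad : (cubeIdeal K).radical = cubeIdeal K := cubeIdeal_isPrime.isRadical.radical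
  have hker (j) : cubeHom K (f j) = 0 := by
    rw [← RingHom.mem_ker, ← cubeIdeal_eq_ker, ← hrad, hf]
    exact Ideal.le_radical (Ideal.subset_span ⟨j, rfl⟩)
  -- At this point the cycle binomial has value 1, since the second matching contains an edge
  -- outside the first.
  let φ : MvPolynomial CubeEdge K →+* K := eval fun e => if e ∈ cyclePos i then 1 else 0
  suffices ∃ j, φ (f j) ≠ 0 by
    obtain ⟨j, hj⟩ := this
    exact ⟨j, exists_support_eq_cyclePos (hker j) hj⟩
  by_contra! hc
  have hle : Ideal.span (Set.range f) ≤ RingHom.ker φ := by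
    rw [Ideal.span_le]
    rintro _ ⟨j, rfl⟩
    exact hc j
  have hmem : cycleBinomial K i ∈ RingHom.ker φ := by
    apply ((RingHom.ker_isPrime φ).isRadical.radical_le_iff.2 hle)
    rw [← hf, hrad, cubeIdeal_eq_cycleIdeal]
    exact cycleBinomial_mem i
  have hdisj : ∀ i, ¬ cycleNeg i ⊆ cyclePos i := by decide
  obtain ⟨e, he, he'⟩ := Finset.not_subset.1 (hdisj i)
  rw [RingHom.mem_ker, cycleBinomial, map_sub, map_prod, map_prod,
    Finset.prod_eq_one fun e he => by simp [φ, he],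
    Finset.prod_eq_zero he (by simp [φ, he']), sub_zero] at hmem
  exact one_ne_zero hmem

theorem support_vertexDegree (m : CubeEdge →₀ ℕ) :
    (vertexDegree m).support = m.support.biUnion fun e => {e.ends.1, e.ends.2} := by
  ext k
  simp only [Finsupp.mem_support_iff, vertexDegree_eq_sum_star, ne_eq, Finset.sum_eq_zero_iff,
    mem_star, Finset.mem_biUnion, Finset.mem_insert, Finset.mem_singleton]
  push Not
  simp only [eq_comm (a := k), and_comm]

/-- Monomials of one vertex degree cover the same vertices, and the ten chordless cycles have
distinct vertex sets. -/
theorem ten_le_ara_cubeG : (10 : ℕ∞) ≤ cubeG.ara (cubeIdeal K) := by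
  refine Grading.le_ara (k := 10) fun n f hf hrad => ?_
  choose j m hm hsupp using exists_mem_support_of_radical_eq hrad
  have hinj : Function.Injective j := fun i i' hii => by
    have h := (hf (j i)).weight_eq (hm i) (by rw [hii]; exact hm i')
    rw [weight_cubeG_eq_iff] at h
    have h' := congrArg Finsupp.support h
    rw [support_vertexDegree, support_vertexDegree, hsupp, hsupp] at h'
    revert h'
    clear * -
    revert i i'
    decide +kernel
  simpa using Fintype.card_le_of_injective j hinj

/-- The cone of the vectors `bVec` is a cone over a cube; these are the functionals of its facets,
which are spanned by the squares of the cube graph. -/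
def facet : Fin 6 → Fin 4 → ℤ :=
  ![![-1, -2, -1, 2], ![7, 32, -5, -5], ![-3, -12, 3, 2], ![-1, -6, 1, 1], ![17, 64, -13, -10],
    ![3, 10, -1, -2]]

/-- The functional is nonnegative on every `bVec e`, so a vanishing sum vanishes termwise. -/
theorem facet_weight_eq_zero_iff (i : Fin 6) (m : CubeEdge →₀ ℕ) :
    ∑ k, facet i k * Finsupp.weight bVec m k = 0 ↔
      ∀ e ∈ m.support, ∑ k, facet i k * bVec e k = 0 := by
  have hpos : ∀ i e, 0 ≤ ∑ k, facet i k * bVec e k := by decide +kernel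
  have h : ∑ k, facet i k * Finsupp.weight bVec m k =
      ∑ e, (m e : ℤ) * ∑ k, facet i k * bVec e k := by
    rw [Finsupp.weight_apply, Finsupp.sum_fintype _ _ (by simp)]
    simp only [Finset.sum_apply, Pi.smul_apply, Finset.mul_sum]
    rw [Finset.sum_comm]
    refine Finset.sum_congr rfl fun e _ => Finset.sum_congr rfl fun k _ => ?_
    rw [nsmul_eq_mul]
    ring
  rw [h, Finset.sum_eq_zero_iff_of_nonneg fun e _ => mul_nonneg (Nat.cast_nonneg _) (hpos i e)]
  simp only [Finset.mem_univ, true_imp_iff, mul_eq_zero, Nat.cast_eq_zero,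
    Finsupp.mem_support_iff, or_iff_not_imp_left, ne_eq]

/-- The `bVec`-degrees separate the six squares and the first hexagon. -/
theorem eq_of_weight_bVec_eq {i j : Fin 7} {m n : CubeEdge →₀ ℕ}
    (hm : m.support = cyclePos (i.castLE (by norm_num)))
    (hn : n.support = cyclePos (j.castLE (by norm_num)))
    (h : Finsupp.weight bVec m = Finsupp.weight bVec n) : i = j := by
  -- The degree of a matching of a square lies on the facet of that square only; that of a hexagon
  -- matching lies on no facet.
  have key (l : Fin 6) : (∀ e ∈ cyclePos (i.castLE (by norm_num)), ∑ k, facet l k * bVec e k = 0) ↔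
      ∀ e ∈ cyclePos (j.castLE (by norm_num)), ∑ k, facet l k * bVec e k = 0 := by
    rw [← hm, ← hn, ← facet_weight_eq_zero_iff, ← facet_weight_eq_zero_iff, h]
  clear * - key
  revert i j
  decide +kernel

theorem seven_le_ara_cubeF : (7 : ℕ∞) ≤ cubeF.ara (cubeIdeal K) := by
  refine Grading.le_ara (k := 7) fun n f hf hrad => ?_
  choose j m hm hsupp using exists_mem_support_of_radical_eq hrad
  have hinj : Function.Injective fun i : Fin 7 => j (i.castLE (by norm_num)) := fun i i' hii => by
    simp only at hii
    have h := (hf _).weight_eq (hm (i.castLE (by norm_num))) (by rw [hii]; exact hm _)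
    exact eq_of_weight_bVec_eq (hsupp _) (hsupp _) ((Grading.weight_ofVectors_eq_iff _ _ _).1 h)
  simpa using Fintype.card_le_of_injective _ hinj

end CubeEdge

/-! ### The height -/

namespace CubeEdge

variable {K : Type v} [Field K]

/-- The edge map of the cube, with an additional variable for each edge in `A`. -/
noncomputable def twistedHom (K : Type v) [Field K] (A : Finset CubeEdge) :
    MvPolynomial CubeEdge K →ₐ[K] MvPolynomial (Fin 8 ⊕ CubeEdge) K :=
  aeval fun e => X (.inl e.ends.1) * X (.inl e.ends.2) * if e ∈ A then X (.inr e) else 1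

theorem twistedHom_empty (p : MvPolynomial CubeEdge K) :
    twistedHom K ∅ p = rename Sum.inl (cubeHom K p) := by
  have : twistedHom K ∅ = (rename Sum.inl).comp (cubeHom K) := by
    ext1 e
    simp [twistedHom, cubeHom]
  rw [this, AlgHom.comp_apply]

theorem ker_twistedHom_empty : RingHom.ker (twistedHom K ∅) = cubeIdeal K := by
  ext p
  rw [cubeIdeal_eq_ker, RingHom.mem_ker, RingHom.mem_ker, twistedHom_empty,
    map_eq_zero_iff _ (rename_injective _ Sum.inl_injective)]

/-- Setting the additional variables outside `A` to 1 turns one map into the other. -/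
theorem ker_twistedHom_anti {A B : Finset CubeEdge} (h : A ⊆ B) :
    RingHom.ker (twistedHom K B) ≤ RingHom.ker (twistedHom K A) := by
  let ψ : MvPolynomial (Fin 8 ⊕ CubeEdge) K →ₐ[K] MvPolynomial (Fin 8 ⊕ CubeEdge) K :=
    aeval (Sum.elim (fun k => X (.inl k)) fun e => if e ∈ A then X (.inr e) else 1)
  have hψ : ψ.comp (twistedHom K B) = twistedHom K A := by
    ext1 e
    by_cases hA : e ∈ A
    · simp [twistedHom, ψ, hA, h hA]
    · by_cases hB : e ∈ B <;> simp [twistedHom, ψ, hA, hB]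
  intro p hp
  rw [RingHom.mem_ker] at hp ⊢
  rw [← hψ, AlgHom.comp_apply, hp, map_zero]

/-- The additional variable of `e` can be set to 0 and all other variables to 1. At the resulting
point a cycle binomial whose first matching alone contains `e` is nonzero, which makes the
inclusions of kernels strict. -/
theorem aeval_eq_zero_of_mem_ker_twistedHom {A : Finset CubeEdge} {e : CubeEdge} (he : e ∈ A)
    {p : MvPolynomial CubeEdge K} (hp : p ∈ RingHom.ker (twistedHom K A)) :
    aeval (fun f => if f = e then (0 : K) else 1) p = 0 := by
  let ψ : MvPolynomial (Fin 8 ⊕ CubeEdge) K →ₐ[K] K :=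
    aeval (Sum.elim (fun _ => 1) fun f => if f = e then 0 else 1)
  have hψ : ψ.comp (twistedHom K A) = aeval (fun f => if f = e then (0 : K) else 1) := by
    ext1 f
    by_cases hf : f = e
    · simp [twistedHom, ψ, hf, he]
    · by_cases hA : f ∈ A <;> simp [twistedHom, ψ, hf, hA]
  rw [RingHom.mem_ker] at hp
  rw [← hψ, AlgHom.comp_apply, hp, map_zero]

theorem twistedHom_cycleBinomial {A : Finset CubeEdge} {i : Fin 10}
    (hp : Disjoint (cyclePos i) A) (hn : Disjoint (cycleNeg i) A) :
    twistedHom K A (cycleBinomial K i) = 0 := by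
  have h : twistedHom K A (cycleBinomial K i) = twistedHom K ∅ (cycleBinomial K i) := by
    simp only [cycleBinomial, twistedHom, map_sub, map_prod, aeval_X, Finset.notMem_empty, if_false]
    congr 1
    · exact Finset.prod_congr rfl fun e he => by rw [if_neg (Finset.disjoint_left.1 hp he)]
    · exact Finset.prod_congr rfl fun e he => by rw [if_neg (Finset.disjoint_left.1 hn he)]
  rw [h, ← RingHom.mem_ker, ker_twistedHom_empty, cubeIdeal_eq_cycleIdeal]
  exact cycleBinomial_mem i

theorem ker_twistedHom_insert_lt {A : Finset CubeEdge} {e : CubeEdge} (i : Fin 10)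
    (hp : Disjoint (cyclePos i) A) (hn : Disjoint (cycleNeg i) A)
    (he : e ∈ cyclePos i) (he' : e ∉ cycleNeg i) :
    RingHom.ker (twistedHom K (insert e A)) < RingHom.ker (twistedHom K A) := by
  refine lt_of_le_not_ge (ker_twistedHom_anti (Finset.subset_insert e A)) fun hle => ?_
  have hmem := hle (RingHom.mem_ker.2 (twistedHom_cycleBinomial hp hn))
  have h0 := aeval_eq_zero_of_mem_ker_twistedHom (Finset.mem_insert_self e A) hmem
  rw [cycleBinomial, map_sub, map_prod, map_prod, Finset.prod_eq_zero he (by simp),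
    Finset.prod_eq_one fun f hf => by simp [ne_of_mem_of_not_mem hf he']] at h0
  simp at h0

theorem height_ker_twistedHom_insert {A : Finset CubeEdge} {e : CubeEdge} (i : Fin 10)
    (hp : Disjoint (cyclePos i) A) (hn : Disjoint (cycleNeg i) A)
    (he : e ∈ cyclePos i) (he' : e ∉ cycleNeg i) :
    (RingHom.ker (twistedHom K (insert e A))).height + 1 ≤
      (RingHom.ker (twistedHom K A)).height := by
  have := RingHom.ker_isPrime (twistedHom K (insert e A))
  have := RingHom.ker_isPrime (twistedHom K A)
  exact Ideal.height_add_one_le_of_lt_of_isPrime (ker_twistedHom_insert_lt i hp hn he he')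

/-- The edges are twisted in an order for which each step has a square through the new edge avoiding
all earlier ones; its binomial leaves the kernel. -/
theorem five_le_height : (5 : ℕ∞) ≤ (cubeIdeal K).height := by
  have h1 := height_ker_twistedHom_insert (K := K) (A := ∅) (e := e78) 5
    (by decide) (by decide) (by decide) (by decide)
  have h2 := height_ker_twistedHom_insert (K := K) (A := {e78}) (e := e56) 1
    (by decide) (by decide) (by decide) (by decide)
  have h3 := height_ker_twistedHom_insert (K := K) (A := {e56, e78}) (e := e67) 2
    (by decide) (by decide) (by decide) (by decide)
  have h4 := height_ker_twistedHom_insert (K := K) (A := {e67, e56, e78}) (e := e58) 4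
    (by decide) (by decide) (by decide) (by decide)
  have h5 := height_ker_twistedHom_insert (K := K) (A := {e58, e67, e56, e78}) (e := e12) 0
    (by decide) (by decide) (by decide) (by decide)
  rw [ker_twistedHom_empty, insert_empty_eq] at h1
  have h := (add_le_add ((add_le_add ((add_le_add ((add_le_add h5 le_rfl).trans h4) le_rfl).trans
    h3) le_rfl).trans h2) le_rfl).trans h1
  refine le_trans ?_ h
  simp only [add_assoc]
  norm_num

theorem X_notMem_cubeIdeal (e : CubeEdge) : X e ∉ cubeIdeal K := by
  rw [cubeIdeal_eq_ker, RingHom.mem_ker, cubeHom, aeval_X]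
  exact mul_ne_zero (X_ne_zero _) (X_ne_zero _)

theorem cycleBinomial_explicit :
    cycleBinomial K 0 = X e12 * X e34 - X e14 * X e23 ∧
    cycleBinomial K 1 = X e12 * X e56 - X e15 * X e26 ∧
    cycleBinomial K 2 = X e23 * X e67 - X e26 * X e37 ∧
    cycleBinomial K 3 = X e34 * X e78 - X e37 * X e48 ∧
    cycleBinomial K 4 = X e14 * X e58 - X e15 * X e48 ∧
    cycleBinomial K 5 = X e56 * X e78 - X e58 * X e67 ∧
    cycleBinomial K 6 = X e23 * X e48 * X e56 - X e26 * X e34 * X e58 ∧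
    cycleBinomial K 7 = X e14 * X e37 * X e56 - X e15 * X e34 * X e67 ∧
    cycleBinomial K 8 = X e12 * X e48 * X e67 - X e14 * X e26 * X e78 ∧
    cycleBinomial K 9 = X e12 * X e37 * X e58 - X e15 * X e23 * X e78 := by
  simp [cycleBinomial, cyclePos, cycleNeg, Finset.prod_insert, mul_assoc]

/-- Modulo the squares, a hexagon is annihilated by edges at the vertices that it avoids. -/
theorem X_mul_hexagon_mem {J : Ideal (MvPolynomial CubeEdge K)}
    (hsq : ∀ i : Fin 5, cycleBinomial K (i.castLE (by norm_num)) ∈ J) :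
    X e14 * cycleBinomial K 6 ∈ J ∧
    X e12 * cycleBinomial K 6 ∈ J ∧
    X e15 * cycleBinomial K 6 ∈ J ∧
    X e12 * cycleBinomial K 7 ∈ J ∧
    X e23 * cycleBinomial K 7 ∈ J ∧
    X e26 * cycleBinomial K 7 ∈ J ∧
    X e23 * cycleBinomial K 8 ∈ J ∧
    X e37 * cycleBinomial K 8 ∈ J ∧
    X e14 * cycleBinomial K 9 ∈ J := by
  obtain ⟨c0, c1, c2, c3, c4, -, c6, c7, c8, c9⟩ := cycleBinomial_explicit (K := K)
  have s0 : cycleBinomial K 0 ∈ J := hsq 0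
  have s1 : cycleBinomial K 1 ∈ J := hsq 1
  have s2 : cycleBinomial K 2 ∈ J := hsq 2
  have s3 : cycleBinomial K 3 ∈ J := hsq 3
  have s4 : cycleBinomial K 4 ∈ J := hsq 4
  refine ⟨?_, ?_, ?_, ?_, ?_, ?_, ?_, ?_, ?_⟩
  -- This identity and the following ones telescope a path of three square moves between the two
  -- monomials of the product.
  · have h : X e14 * cycleBinomial K 6 =
        -(X e48 * X e56) * cycleBinomial K 0 + X e34 * X e48 * cycleBinomial K 1 -
          X e26 * X e34 * cycleBinomial K 4 := by
      rw [c0, c1, c4, c6]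
      ring
    rw [h]
    exact J.sub_mem (J.add_mem (J.mul_mem_left _ s0) (J.mul_mem_left _ s1)) (J.mul_mem_left _ s4)
  · have h : X e12 * cycleBinomial K 6 =
        X e23 * X e48 * cycleBinomial K 1 - X e26 * X e58 * cycleBinomial K 0 -
          X e23 * X e26 * cycleBinomial K 4 := by
      rw [c0, c1, c4, c6]
      ring
    rw [h]
    exact J.sub_mem (J.sub_mem (J.mul_mem_left _ s1) (J.mul_mem_left _ s0)) (J.mul_mem_left _ s4)
  · have h : X e15 * cycleBinomial K 6 =
        -(X e23 * X e56) * cycleBinomial K 4 + X e34 * X e58 * cycleBinomial K 1 -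
          X e56 * X e58 * cycleBinomial K 0 := by
      rw [c0, c1, c4, c6]
      ring
    rw [h]
    exact J.sub_mem (J.add_mem (J.mul_mem_left _ s4) (J.mul_mem_left _ s1)) (J.mul_mem_left _ s0)
  · have h : X e12 * cycleBinomial K 7 =
        X e14 * X e37 * cycleBinomial K 1 - X e15 * X e67 * cycleBinomial K 0 -
          X e14 * X e15 * cycleBinomial K 2 := by
      rw [c0, c1, c2, c7]
      ring
    rw [h]
    exact J.sub_mem (J.sub_mem (J.mul_mem_left _ s1) (J.mul_mem_left _ s0)) (J.mul_mem_left _ s2)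
  · have h : X e23 * cycleBinomial K 7 =
        -(X e37 * X e56) * cycleBinomial K 0 - X e15 * X e34 * cycleBinomial K 2 +
          X e34 * X e37 * cycleBinomial K 1 := by
      rw [c0, c1, c2, c7]
      ring
    rw [h]
    exact J.add_mem (J.sub_mem (J.mul_mem_left _ s0) (J.mul_mem_left _ s2)) (J.mul_mem_left _ s1)
  · have h : X e26 * cycleBinomial K 7 =
        -(X e14 * X e56) * cycleBinomial K 2 + X e34 * X e67 * cycleBinomial K 1 -
          X e56 * X e67 * cycleBinomial K 0 := by
      rw [c0, c1, c2, c7]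
      ring
    rw [h]
    exact J.sub_mem (J.add_mem (J.mul_mem_left _ s2) (J.mul_mem_left _ s1)) (J.mul_mem_left _ s0)
  · have h : X e23 * cycleBinomial K 8 =
        X e12 * X e48 * cycleBinomial K 2 + X e26 * X e78 * cycleBinomial K 0 -
          X e12 * X e26 * cycleBinomial K 3 := by
      rw [c0, c2, c3, c8]
      ring
    rw [h]
    exact J.sub_mem (J.add_mem (J.mul_mem_left _ s2) (J.mul_mem_left _ s0)) (J.mul_mem_left _ s3)
  · have h : X e37 * cycleBinomial K 8 =
        -(X e12 * X e67) * cycleBinomial K 3 + X e14 * X e78 * cycleBinomial K 2 +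
          X e67 * X e78 * cycleBinomial K 0 := by
      rw [c0, c2, c3, c8]
      ring
    rw [h]
    exact J.add_mem (J.add_mem (J.mul_mem_left _ s3) (J.mul_mem_left _ s2)) (J.mul_mem_left _ s0)
  · have h : X e14 * cycleBinomial K 9 =
        X e12 * X e37 * cycleBinomial K 4 + X e15 * X e78 * cycleBinomial K 0 -
          X e12 * X e15 * cycleBinomial K 3 := by
      rw [c0, c3, c4, c9]
      ring
    rw [h]
    exact J.sub_mem (J.add_mem (J.mul_mem_left _ s4) (J.mul_mem_left _ s0)) (J.mul_mem_left _ s3)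

/-- The product of two different hexagons lies in the ideal of the squares. -/
theorem hexagon_mul_hexagon_mem {J : Ideal (MvPolynomial CubeEdge K)}
    (hsq : ∀ i : Fin 5, cycleBinomial K (i.castLE (by norm_num)) ∈ J) :
    cycleBinomial K 6 * cycleBinomial K 7 ∈ J ∧
    cycleBinomial K 6 * cycleBinomial K 8 ∈ J ∧
    cycleBinomial K 6 * cycleBinomial K 9 ∈ J ∧
    cycleBinomial K 7 * cycleBinomial K 8 ∈ J ∧
    cycleBinomial K 7 * cycleBinomial K 9 ∈ J ∧
    cycleBinomial K 8 * cycleBinomial K 9 ∈ J := by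
  obtain ⟨-, -, -, -, -, -, -, c7, c8, c9⟩ := cycleBinomial_explicit (K := K)
  obtain ⟨h6_14, h6_12, h6_15, h7_12, h7_23, h7_26, h8_23, h8_37, -⟩ :=
    X_mul_hexagon_mem hsq
  refine ⟨?_, ?_, ?_, ?_, ?_, ?_⟩
  -- In each product, both monomials of the second hexagon contain an edge that annihilates the
  -- first one modulo the squares.
  · have h : cycleBinomial K 6 * cycleBinomial K 7 =
        X e37 * X e56 * (X e14 * cycleBinomial K 6) -
          X e34 * X e67 * (X e15 * cycleBinomial K 6) := by
      rw [c7]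
      ring
    rw [h]
    exact J.sub_mem (J.mul_mem_left _ h6_14) (J.mul_mem_left _ h6_15)
  · have h : cycleBinomial K 6 * cycleBinomial K 8 =
        X e48 * X e67 * (X e12 * cycleBinomial K 6) -
          X e26 * X e78 * (X e14 * cycleBinomial K 6) := by
      rw [c8]
      ring
    rw [h]
    exact J.sub_mem (J.mul_mem_left _ h6_12) (J.mul_mem_left _ h6_14)
  · have h : cycleBinomial K 6 * cycleBinomial K 9 =
        X e37 * X e58 * (X e12 * cycleBinomial K 6) -
          X e23 * X e78 * (X e15 * cycleBinomial K 6) := by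
      rw [c9]
      ring
    rw [h]
    exact J.sub_mem (J.mul_mem_left _ h6_12) (J.mul_mem_left _ h6_15)
  · have h : cycleBinomial K 7 * cycleBinomial K 8 =
        X e48 * X e67 * (X e12 * cycleBinomial K 7) -
          X e14 * X e78 * (X e26 * cycleBinomial K 7) := by
      rw [c8]
      ring
    rw [h]
    exact J.sub_mem (J.mul_mem_left _ h7_12) (J.mul_mem_left _ h7_26)
  · have h : cycleBinomial K 7 * cycleBinomial K 9 =
        X e37 * X e58 * (X e12 * cycleBinomial K 7) -
          X e15 * X e78 * (X e23 * cycleBinomial K 7) := by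
      rw [c9]
      ring
    rw [h]
    exact J.sub_mem (J.mul_mem_left _ h7_12) (J.mul_mem_left _ h7_23)
  · have h : cycleBinomial K 8 * cycleBinomial K 9 =
        X e12 * X e58 * (X e37 * cycleBinomial K 8) -
          X e15 * X e78 * (X e23 * cycleBinomial K 8) := by
      rw [c9]
      ring
    rw [h]
    exact J.sub_mem (J.mul_mem_left _ h8_37) (J.mul_mem_left _ h8_23)

/-- A prime ideal inside the cube ideal that contains five of the squares is the cube ideal. -/
theorem cubeIdeal_le_of_squares_mem {Q : Ideal (MvPolynomial CubeEdge K)} (hQ : Q.IsPrime)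
    (hle : Q ≤ cubeIdeal K) (hsq : ∀ i : Fin 5, cycleBinomial K (i.castLE (by norm_num)) ∈ Q) :
    cubeIdeal K ≤ Q := by
  obtain ⟨-, -, c2, c3, -, c5, c6, -, -, -⟩ := cycleBinomial_explicit (K := K)
  -- No variable lies in the cube ideal, hence none in `Q`, so variables can be cancelled.
  have cancel (e : CubeEdge) {p : MvPolynomial CubeEdge K} (h : X e * p ∈ Q) : p ∈ Q :=
    (hQ.mem_or_mem h).resolve_left fun h' => X_notMem_cubeIdeal e (hle h')
  have s2 : cycleBinomial K 2 ∈ Q := hsq 2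
  have s3 : cycleBinomial K 3 ∈ Q := hsq 3
  obtain ⟨h6, -, -, h7, -, -, h8, -, h9⟩ := X_mul_hexagon_mem hsq
  have h5 : X e23 * (X e48 * cycleBinomial K 5) = X e78 * cycleBinomial K 6 -
      X e48 * X e58 * cycleBinomial K 2 + X e26 * X e58 * cycleBinomial K 3 := by
    rw [c2, c3, c5, c6]
    ring
  have s5 : cycleBinomial K 5 ∈ Q := cancel e48 <| cancel e23 <| by
    rw [h5]
    exact Q.add_mem (Q.sub_mem (Q.mul_mem_left _ (cancel _ h6)) (Q.mul_mem_left _ s2))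
      (Q.mul_mem_left _ s3)
  rw [cubeIdeal_eq_cycleIdeal, cycleIdeal, Ideal.span_le]
  rintro _ ⟨i, rfl⟩
  fin_cases i
  exacts [hsq 0, hsq 1, s2, s3, hsq 4, s5, cancel _ h6, cancel _ h7, cancel _ h8, cancel _ h9]

/-- The cube ideal is a minimal prime over five squares, so Krull's height theorem applies. -/
theorem height_le_five : (cubeIdeal K).height ≤ 5 := by
  classical
  let s : Finset (MvPolynomial CubeEdge K) :=
    Finset.univ.image fun i : Fin 5 => cycleBinomial K (i.castLE (by norm_num))
  have hs : (cubeIdeal K) ∈ (Ideal.span (s : Set (MvPolynomial CubeEdge K))).minimalPrimes := by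
    refine ⟨⟨cubeIdeal_isPrime, ?_⟩, fun Q hQ hle => ?_⟩
    · rw [Ideal.span_le, cubeIdeal_eq_cycleIdeal]
      intro p hp
      obtain ⟨i, -, rfl⟩ := Finset.mem_image.1 hp
      exact cycleBinomial_mem _
    · refine cubeIdeal_le_of_squares_mem hQ.1 hle fun i => hQ.2 (Ideal.subset_span ?_)
      exact Finset.mem_image_of_mem _ (Finset.mem_univ i)
  refine (Ideal.height_le_card_of_mem_minimalPrimes_span_finset hs).trans ?_
  exact_mod_cast Finset.card_image_le.trans (by simp)

end CubeEdge

/-! ### Upper bounds for the arithmetical ranks -/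

theorem Finsupp.weight_ulift_prod {σ A B : Type*} [AddCommMonoid A] [AddCommMonoid B]
    (f : σ → A) (g : σ → B) (m : σ →₀ ℕ) :
    Finsupp.weight (fun i => (⟨(f i, g i)⟩ : ULift.{u} (A × B))) m =
      ⟨(Finsupp.weight f m, Finsupp.weight g m)⟩ := by
  let φ : ULift.{u} (A × B) →+ A := (AddMonoidHom.fst A B).comp AddEquiv.ulift.toAddMonoidHom
  let ψ : ULift.{u} (A × B) →+ B := (AddMonoidHom.snd A B).comp AddEquiv.ulift.toAddMonoidHom
  exact ULift.ext _ _ (Prod.ext (Finsupp.weight_map φ _ m).symm (Finsupp.weight_map ψ _ m).symm)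

namespace CubeEdge

variable {K : Type v} [Field K]

/-- The degree map of `bVec` on the vertices: `bVec e` is the sum of the values at the ends of
`e`. -/
def vertexWeight : Fin 8 → Fin 4 → ℤ :=
  -- Normalised to 0 at the vertex 1; its neighbours then receive `bVec` of the connecting edge, and
  -- the other values are forced.
  ![![0, 0, 0, 0], ![5, 0, 3, 4], ![-1, 0, -1, -1], ![3, 1, 5, 5], ![4, 1, 4, 8], ![0, 0, -2, 2],
    ![3, 1, 3, 7], ![-2, 1, 0, 3]]

theorem bVec_eq (e : CubeEdge) : bVec e = vertexWeight e.ends.1 + vertexWeight e.ends.2 := by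
  cases e <;> decide

theorem weight_bVec_eq_of_vertexDegree_eq {m n : CubeEdge →₀ ℕ}
    (h : vertexDegree m = vertexDegree n) : Finsupp.weight bVec m = Finsupp.weight bVec n := by
  have key (m : CubeEdge →₀ ℕ) :
      Finsupp.weight bVec m = Finsupp.weight vertexWeight (vertexDegree m) := by
    rw [vertexDegree, ← Finsupp.weight_map]
    congr 2
    ext1 e
    simp [bVec_eq, Finsupp.weight_single]
  rw [key, key, h]

theorem isSpecialization_cubeF_cubeG : Grading.IsSpecialization K cubeF cubeG := by
  rw [Grading.isSpecialization_iff]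
  intro m n h
  rw [weight_cubeG_eq_iff] at h
  exact (Grading.weight_ofVectors_eq_iff _ _ _).2 (weight_bVec_eq_of_vertexDegree_eq h)

theorem cycleBinomial_isHomogeneous_cubeG (i : Fin 10) :
    cubeG.IsHomogeneous (cycleBinomial K i) := by
  rw [cycleBinomial_eq]
  exact ⟨_, (isWeightedHomogeneous_monomial _ _ _ rfl).sub
    (isWeightedHomogeneous_monomial _ _ _ ((weight_cubeG_eq_iff _ _).2
      (vertexDegree_cyclePos i).symm))⟩

theorem ara_cubeG_le_ten : cubeG.ara (cubeIdeal K) ≤ 10 := by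
  refine Grading.ara_le (n := 10) (cycleBinomial K) cycleBinomial_isHomogeneous_cubeG ?_
  rw [cubeIdeal_eq_cycleIdeal, cycleIdeal]

/-- The six squares and the sum of the four hexagons. -/
noncomputable def squaresAndHexagonSum (K : Type v) [Field K] :
    Fin 7 → MvPolynomial CubeEdge K :=
  Fin.snoc (fun i : Fin 6 => cycleBinomial K (i.castLE (by norm_num)))
    (cycleBinomial K 6 + cycleBinomial K 7 + cycleBinomial K 8 + cycleBinomial K 9)

theorem squaresAndHexagonSum_castSucc (i : Fin 6) :
    squaresAndHexagonSum K i.castSucc = cycleBinomial K (i.castLE (by norm_num)) :=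
  Fin.snoc_castSucc (α := fun _ => MvPolynomial CubeEdge K) _ _ i

theorem squaresAndHexagonSum_last : squaresAndHexagonSum K (Fin.last 6) =
    cycleBinomial K 6 + cycleBinomial K 7 + cycleBinomial K 8 + cycleBinomial K 9 :=
  Fin.snoc_last (α := fun _ => MvPolynomial CubeEdge K) _ _

/-- Each hexagon omits an antipodal pair of vertices, and in `vertexWeight` every such pair has sum
`(3, 1, 3, 7)`; hence all eight hexagon matchings have the same degree. -/
theorem hexagonSum_isHomogeneous_cubeF : cubeF.IsHomogeneous
    (cycleBinomial K 6 + cycleBinomial K 7 + cycleBinomial K 8 + cycleBinomial K 9) := by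
  have hw {s : Finset CubeEdge} (h : ∑ e ∈ s, bVec e = ∑ e ∈ cyclePos 6, bVec e) :
      Finsupp.weight cubeF.gen (squarefreeExponent s) =
        Finsupp.weight cubeF.gen (squarefreeExponent (cyclePos 6)) := by
    refine (Grading.weight_ofVectors_eq_iff _ _ _).2 ?_
    simpa [squarefreeExponent, map_sum, Finsupp.weight_single] using h
  have key (i : Fin 10) (hp : ∑ e ∈ cyclePos i, bVec e = ∑ e ∈ cyclePos 6, bVec e)
      (hn : ∑ e ∈ cycleNeg i, bVec e = ∑ e ∈ cyclePos 6, bVec e) :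
      IsWeightedHomogeneous cubeF.gen (cycleBinomial K i)
        (Finsupp.weight cubeF.gen (squarefreeExponent (cyclePos 6))) := by
    rw [cycleBinomial_eq]
    exact (isWeightedHomogeneous_monomial _ _ _ (hw hp)).sub
      (isWeightedHomogeneous_monomial _ _ _ (hw hn))
  exact ⟨_, (((key 6 (by decide) (by decide)).add (key 7 (by decide) (by decide))).add
    (key 8 (by decide) (by decide))).add (key 9 (by decide) (by decide))⟩

/-- Multiplying the sum by one hexagon leaves the square of that hexagon modulo the mixed products,
which lie in the ideal of the squares. -/
theorem radical_squaresAndHexagonSum : (cubeIdeal K).radical =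
    (Ideal.span (Set.range (squaresAndHexagonSum K))).radical := by
  rw [cubeIdeal_eq_cycleIdeal]
  set J := Ideal.span (Set.range (squaresAndHexagonSum K))
  have hmem (i : Fin 7) : squaresAndHexagonSum K i ∈ J := Ideal.subset_span ⟨i, rfl⟩
  have hsq (i : Fin 6) : cycleBinomial K (i.castLE (by norm_num)) ∈ J :=
    squaresAndHexagonSum_castSucc (K := K) i ▸ hmem i.castSucc
  have hsum : cycleBinomial K 6 + cycleBinomial K 7 + cycleBinomial K 8 +
      cycleBinomial K 9 ∈ J :=
    squaresAndHexagonSum_last (K := K) ▸ hmem (Fin.last 6)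
  obtain ⟨h67, h68, h69, h78, h79, h89⟩ := hexagon_mul_hexagon_mem fun i => hsq i.castSucc
  apply le_antisymm
  · refine (Ideal.radical_isRadical J).radical_le_iff.2 ?_
    rw [cycleIdeal, Ideal.span_le]
    have sq_mem {p q : MvPolynomial CubeEdge K} (hq : q ∈ J)
        (h : p * (cycleBinomial K 6 + cycleBinomial K 7 + cycleBinomial K 8 +
          cycleBinomial K 9) - q = p ^ 2) : p ∈ J.radical :=
      ⟨2, h ▸ J.sub_mem (J.mul_mem_left _ hsum) hq⟩
    have h6 := sq_mem (p := cycleBinomial K 6) (J.add_mem (J.add_mem h67 h68) h69) (by ring)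
    have h7 := sq_mem (p := cycleBinomial K 7) (J.add_mem (J.add_mem h67 h78) h79) (by ring)
    have h8 := sq_mem (p := cycleBinomial K 8) (J.add_mem (J.add_mem h68 h78) h89) (by ring)
    have h9 := sq_mem (p := cycleBinomial K 9) (J.add_mem (J.add_mem h69 h79) h89) (by ring)
    have hsq' (i : Fin 6) := Ideal.le_radical (hsq i)
    rintro _ ⟨i, rfl⟩
    fin_cases i
    exacts [hsq' 0, hsq' 1, hsq' 2, hsq' 3, hsq' 4, hsq' 5, h6, h7, h8, h9]
  · refine Ideal.radical_mono (Ideal.span_le.2 ?_)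
    rintro _ ⟨i, rfl⟩
    have hc := cycleBinomial_mem (K := K)
    refine Fin.lastCases ?_ (fun i => ?_) i
    · rw [squaresAndHexagonSum_last]
      exact add_mem (add_mem (add_mem (hc 6) (hc 7)) (hc 8)) (hc 9)
    · rw [squaresAndHexagonSum_castSucc]
      exact hc _

theorem ara_cubeF_le_seven : cubeF.ara (cubeIdeal K) ≤ 7 := by
  refine Grading.ara_le (n := 7) (squaresAndHexagonSum K) (fun i => ?_)
    radical_squaresAndHexagonSum
  refine Fin.lastCases ?_ (fun i => ?_) i
  · rw [squaresAndHexagonSum_last]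
    exact hexagonSum_isHomogeneous_cubeF
  · rw [squaresAndHexagonSum_castSucc]
    exact isSpecialization_cubeF_cubeG.isHomogeneous (cycleBinomial_isHomogeneous_cubeG _)

/-! ### Infinitely many intermediate gradings -/

/-- The vectors of `bVec`, extended by the degree at the vertex `1` modulo `r`. -/
def modVec (r : ℕ) (e : CubeEdge) : ULift.{u} ((Fin 4 → ℤ) × ZMod r) :=
  ⟨(bVec e, (aVec e 0 : ZMod r))⟩

/-- The refinement of `cubeF` by the degree at the vertex `1` modulo `r`. -/
def modGrading (r : ℕ) : Grading.{u} CubeEdge := Grading.ofVectors (modVec r)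

theorem weight_modGrading_eq_iff (r : ℕ) (m n : CubeEdge →₀ ℕ) :
    Finsupp.weight (modGrading.{u} r).gen m = Finsupp.weight (modGrading.{u} r).gen n ↔
      Finsupp.weight bVec m = Finsupp.weight bVec n ∧
        ((Finsupp.weight aVec m 0 : ℤ) : ZMod r) = (Finsupp.weight aVec n 0 : ℤ) := by
  have hcast (m : CubeEdge →₀ ℕ) : Finsupp.weight (fun e => (aVec e 0 : ZMod r)) m =
      ((Finsupp.weight aVec m 0 : ℤ) : ZMod r) :=
    Finsupp.weight_map ((Int.castAddHom (ZMod r)).comp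
      (Pi.evalAddMonoidHom (fun _ : Fin 8 => ℤ) 0)) aVec m
  have h (m : CubeEdge →₀ ℕ) : Finsupp.weight (modVec.{u} r) m =
      ⟨(Finsupp.weight bVec m, ((Finsupp.weight aVec m 0 : ℤ) : ZMod r))⟩ := by
    rw [← hcast]
    exact Finsupp.weight_ulift_prod _ _ m
  rw [modGrading, Grading.weight_ofVectors_eq_iff, h, h, ULift.up_inj, Prod.mk.injEq]

theorem isSpecialization_cubeF_modGrading (r : ℕ) :
    Grading.IsSpecialization K cubeF (modGrading.{u} r) := by
  rw [Grading.isSpecialization_iff]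
  intro m n h
  exact (Grading.weight_ofVectors_eq_iff _ _ _).2 ((weight_modGrading_eq_iff r m n).1 h).1

theorem isSpecialization_modGrading_cubeG (r : ℕ) :
    Grading.IsSpecialization K (modGrading.{u} r) cubeG := by
  rw [Grading.isSpecialization_iff]
  intro m n h
  rw [weight_cubeG_eq_iff] at h
  rw [weight_modGrading_eq_iff, (weight_aVec_eq_iff m n).2 h]
  exact ⟨weight_bVec_eq_of_vertexDegree_eq h, rfl⟩

/-- The binomial with exponents `k (e₁₅ + 2 e₂₃)` and `k (2 e₁₂ + e₃₇)` detects the modulus. -/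
theorem weight_modGrading_eq_iff_dvd (r k : ℕ) :
    Finsupp.weight (modGrading.{u} r).gen (Finsupp.single e15 k + Finsupp.single e23 (2 * k)) =
      Finsupp.weight (modGrading.{u} r).gen
        (Finsupp.single e12 (2 * k) + Finsupp.single e37 k) ↔ r ∣ k := by
  rw [weight_modGrading_eq_iff]
  -- This is `k` times the relation `b₁₅ + 2 b₂₃ = 2 b₁₂ + b₃₇`, whose sides have degrees 1 and 2 at
  -- the vertex 1.
  have hb : Finsupp.weight bVec (Finsupp.single e15 k + Finsupp.single e23 (2 * k)) =
      Finsupp.weight bVec (Finsupp.single e12 (2 * k) + Finsupp.single e37 k) := by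
    simp only [map_add, Finsupp.weight_single, mul_comm 2 k, mul_smul, ← smul_add]
    congr 1
    decide
  have ha : Finsupp.weight aVec (Finsupp.single e15 k + Finsupp.single e23 (2 * k)) 0 = k := by
    have h1 : aVec e15 0 = 1 := rfl
    have h2 : aVec e23 0 = 0 := rfl
    rw [map_add, Finsupp.weight_single, Finsupp.weight_single, Pi.add_apply, Pi.smul_apply,
      Pi.smul_apply, h1, h2]
    simp
  have ha' : Finsupp.weight aVec (Finsupp.single e12 (2 * k) + Finsupp.single e37 k) 0 =
      k + k := by
    have h1 : aVec e12 0 = 1 := rfl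
    have h2 : aVec e37 0 = 0 := rfl
    rw [map_add, Finsupp.weight_single, Finsupp.weight_single, Pi.add_apply, Pi.smul_apply,
      Pi.smul_apply, h1, h2]
    simp [two_mul]
  rw [ha, ha', ← ZMod.natCast_eq_zero_iff, and_iff_right hb]
  push_cast
  rw [left_eq_add]

/-- Applying a specialization to the test binomial with `k = s` gives `r ∣ s`, so equivalent
gradings have equal moduli. The modulus 0 is covered, as `ZMod 0` is `ℤ`. -/
theorem infinite_gradings (K : Type v) [Field K] :
    {c : Quotient (Grading.equivalence.{u} K CubeEdge) | ∃ H : Grading.{u} CubeEdge,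
      c = Quotient.mk (Grading.equivalence K CubeEdge) H ∧
        Grading.IsSpecialization K cubeF H ∧ Grading.IsSpecialization K H cubeG}.Infinite := by
  refine Set.infinite_of_injective_forall_mem
    (f := fun r : ℕ => Quotient.mk (Grading.equivalence.{u} K CubeEdge) (modGrading r)) ?_
    fun r => ⟨modGrading r, rfl, isSpecialization_cubeF_modGrading r,
      isSpecialization_modGrading_cubeG r⟩
  have key {r s : ℕ} (h : Grading.IsSpecialization K (modGrading.{u} r) (modGrading.{u} s)) :
      r ∣ s :=
    (weight_modGrading_eq_iff_dvd.{u} r s).1 <| (Grading.isSpecialization_iff _ _).1 h _ _ <|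
      (weight_modGrading_eq_iff_dvd.{u} s s).2 dvd_rfl
  intro r s hrs
  have h := Quotient.exact hrs
  exact Nat.dvd_antisymm (key fun J => (h J).2) (key fun J => (h J).1)

end CubeEdge

open CubeEdge

theorem mainTheorem10 (K : Type v) [Field K] :
    (cubeIdeal K).IsPrime ∧
    cubeIdeal K = RingHom.ker (cubeHom K) ∧
    Grading.IsSpecialization K cubeF cubeG ∧
    cubeG.ara (cubeIdeal K) = 10 ∧
    cubeF.ara (cubeIdeal K) = 7 ∧
    (cubeIdeal K).height = 5 ∧
    (∀ H : Grading.{u} CubeEdge,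
      Grading.IsSpecialization K cubeF H → Grading.IsSpecialization K H cubeG →
        7 ≤ H.ara (cubeIdeal K) ∧ H.ara (cubeIdeal K) ≤ 10 ∧
        ¬ H.IsSetTheoreticCI (cubeIdeal K)) ∧
    {c : Quotient (Grading.equivalence.{u} K CubeEdge) | ∃ H : Grading.{u} CubeEdge,
      c = Quotient.mk (Grading.equivalence K CubeEdge) H ∧
        Grading.IsSpecialization K cubeF H ∧ Grading.IsSpecialization K H cubeG}.Infinite := by
  have hht : (cubeIdeal K).height = 5 := le_antisymm height_le_five five_le_height
  refine ⟨cubeIdeal_isPrime, cubeIdeal_eq_ker, isSpecialization_cubeF_cubeG,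
    le_antisymm ara_cubeG_le_ten ten_le_ara_cubeG,
    le_antisymm ara_cubeF_le_seven seven_le_ara_cubeF, hht, fun H hF hG => ?_,
    infinite_gradings K⟩
  have h7 : 7 ≤ H.ara (cubeIdeal K) := seven_le_ara_cubeF.trans (hF.ara_le _)
  refine ⟨h7, (hG.ara_le _).trans ara_cubeG_le_ten, fun h => ?_⟩
  rw [Grading.IsSetTheoreticCI, hht] at h
  rw [← h] at h7
  exact absurd h7 (by decide)
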